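/- \textbf{Conventions.} Affine group schemes are over $\mathbf{C}$; representations are complex and finite dimensional. For a group $H$, the \emph{pro-reductive completion} (Tannaka closure) of $H$ is the affine group scheme $G=\operatorname{Spec}R(H)$, where $R(H)$ is the algebra of representation functions on $H$, i.e. the algebra of functions $H\to\mathbf{C}$ generated by the coefficients $h\mapsto\varphi(\rho(h)v)$ of semisimple representations $\rho$ of $H$ (with comultiplication $f\mapsto((h,k)\mapsto f(hk))$), together with the homomorphism $H\to G(\mathbf{C})$ sending $h$ to evaluation at $h$. More generally the name is used for any affine group scheme with a homomorphism from $H$ to its complex points that is isomorphic to this pair. A \emph{complex reductive group} is an affine algebraic group over $\mathbf{C}$ (not necessarily connected) all of whose finite-dimensional algebraic representations are completely reducible. \textbf{Statement.} Let $X$ be a connected compact K\"ahler manifold or, more generally, any topological space; let $p:Y\to X$ be a covering map, $y\in Y$, and let $\chi':\pi_1(X,p(y))\to \mathrm{U}(1)$ be a unitary character of finite order such that $p_*\pi_1(Y,y)=\ker\chi'$. Let $G$ be the pro-reductive completion of $\pi_1(X,p(y))$. Then $\chi'$ has a unique extension to a character $\chi:G\to\mathbf{G}_m$. Let $K=\ker\chi$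 (the scheme-theoretic kernel). Then the composite $\pi_1(Y,y)\to\pi_1(X,p(y))\to G(\mathbf{C})$ factors through a homomorphism $\iota:\pi_1(Y,y)\to K(\mathbf{C})$, and: \begin{enumerate} \item every semisimple finite-dimensional complex representation of $\pi_1(Y,y)$ extends uniquely, along $\iota$, to an algebraic representation of $K$ on the same space; \item $(K,\iota)$ is the pro-reductive completion of $\pi_1(Y,y)$; \item in particular, for every complex reductive group $\Gamma$ and every homomorphism $\rho:\pi_1(Y,y)\to\Gamma(\mathbf{C})$ with Zariski-dense image there is a unique morphism of affine group schemes $f:K\to\Gamma$ with $f\circ\iota=\rho$. \end{enumerate} -/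

import Mathlib

open scoped TensorProduct

noncomputable section

namespace ProReductive

universe u v w

/-! ### Affine group schemes over `ℂ`

An affine group scheme over `ℂ` is given by its coordinate ring, a commutative Hopf algebra `A`
over `ℂ`.  A morphism `Spec A → Spec B` is a bialgebra homomorphism `B →ₐc[ℂ] A`. -/

section AffineGroups

/-- The group of complex points of the affine group scheme with coordinate ring `A`: the algebra
homomorphisms `A → ℂ`, multiplied by convolution. -/
abbrev Points (A : Type u) [CommRing A] [HopfAlgebra ℂ A] : Type u :=
  WithConv (A →ₐ[ℂ] ℂ)

variable {A : Type u} [CommRing A] [HopfAlgebra ℂ A]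

/-- An algebraic representation on `V` of the affine group scheme with coordinate ring `A`,
i.e. a (right) comodule structure over `A`. -/
structure AlgRep (A : Type u) [CommRing A] [HopfAlgebra ℂ A]
    (V : Type v) [AddCommGroup V] [Module ℂ V] where
  coact : V →ₗ[ℂ] V ⊗[ℂ] A
  coassoc : (TensorProduct.assoc ℂ V A A).toLinearMap ∘ₗ coact.rTensor A ∘ₗ coact =
    (Coalgebra.comul (R := ℂ) (A := A)).lTensor V ∘ₗ coact
  counit : (TensorProduct.rid ℂ V).toLinearMap ∘ₗ
    (Coalgebra.counit (R := ℂ) (A := A)).lTensor V ∘ₗ coact = LinearMap.id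

variable {V : Type v} [AddCommGroup V] [Module ℂ V]

/-- The action of a complex point on the space of an algebraic representation. -/
def AlgRep.act (σ : AlgRep A V) (g : Points A) : V →ₗ[ℂ] V :=
  (TensorProduct.rid ℂ V).toLinearMap ∘ₗ g.ofConv.toLinearMap.lTensor V ∘ₗ σ.coact

/-- A subspace `W` is a subrepresentation if the coaction maps `W` into `W ⊗ A`. -/
def AlgRep.IsSub (σ : AlgRep A V) (W : Submodule ℂ V) : Prop :=
  ∀ w ∈ W, σ.coact w ∈ LinearMap.range (W.subtype.rTensor A)

/-- Complex reductive groups (not necessarily connected): affine algebraic groups over `ℂ` all of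
whose finite-dimensional algebraic representations are completely reducible. -/
structure IsReductiveGroup (A : Type u) [CommRing A] [HopfAlgebra ℂ A] : Prop where
  finiteType : Algebra.FiniteType ℂ A
  completelyReducible : ∀ (n : ℕ) (σ : AlgRep A (Fin n → ℂ)) (W : Submodule ℂ (Fin n → ℂ)),
    σ.IsSub W → ∃ W' : Submodule ℂ (Fin n → ℂ), σ.IsSub W' ∧ IsCompl W W'

/-- A homomorphism from an abstract group to the complex points of an affine group scheme has
Zariski dense image if a function vanishing on the image is zero. -/
def ZariskiDense {H : Type v} [Group H] (ρ : H →* Points A) : Prop :=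
  ∀ a : A, (∀ h, ρ h a = 0) → a = 0

variable {B : Type v} [CommRing B] [HopfAlgebra ℂ B]

/-- The ideal defining the kernel of the morphism of affine group schemes `Spec A → Spec B` given
by `f : B → A`: the ideal generated by the image of the augmentation ideal of `B`. -/
def kerIdeal (f : B →ₐc[ℂ] A) : Ideal A :=
  Ideal.map (f : B →ₐ[ℂ] A) (RingHom.ker (Bialgebra.counitAlgHom ℂ B))

lemma mk_apply_kerIdeal (f : B →ₐc[ℂ] A) (b : B) :
    Ideal.Quotient.mk (kerIdeal f) (f b) =
      algebraMap ℂ (A ⧸ kerIdeal f) (Coalgebra.counit (R := ℂ) b) := by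
  have h : f (b - algebraMap ℂ B (Coalgebra.counit (R := ℂ) b)) ∈ kerIdeal f := by
    refine Ideal.mem_map_of_mem (f : B →ₐ[ℂ] A) ?_
    simp [RingHom.mem_ker]
  rw [← Ideal.Quotient.eq_zero_iff_mem, map_sub, map_sub, sub_eq_zero] at h
  rw [h]
  have h2 : f (algebraMap ℂ B (Coalgebra.counit (R := ℂ) b)) =
      algebraMap ℂ A (Coalgebra.counit (R := ℂ) b) := AlgHomClass.commutes f _
  rw [h2]
  rfl

lemma map_antipode (f : B →ₐc[ℂ] A) (b : B) :
    HopfAlgebra.antipode ℂ (f b) = f (HopfAlgebra.antipode ℂ b) := by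
  have h : (HopfAlgebra.antipode ℂ (A := A)) ∘ₗ (f : B →ₐ[ℂ] A).toLinearMap =
      (f : B →ₐ[ℂ] A).toLinearMap ∘ₗ HopfAlgebra.antipode ℂ (A := B) := by
    apply WithConv.toConv_injective
    apply left_inv_eq_right_inv (a := WithConv.toConv (f : B →ₐ[ℂ] A).toLinearMap)
    · have h1 := LinearMap.convMul_comp_coalgHom_distrib
        (WithConv.toConv (HopfAlgebra.antipode ℂ (A := A))) (WithConv.toConv LinearMap.id)
        (f : B →ₗc[ℂ] A)
      rw [LinearMap.antipode_mul_id] at h1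
      apply WithConv.ofConv_injective
      rw [← LinearMap.convOne_comp_coalgHom (f : B →ₗc[ℂ] A)]
      exact h1.symm
    · have h1 := LinearMap.algHom_comp_convMul_distrib (f : B →ₐ[ℂ] A)
        (WithConv.toConv LinearMap.id) (WithConv.toConv (HopfAlgebra.antipode ℂ (A := B)))
      rw [LinearMap.id_mul_antipode, LinearMap.algHom_comp_convOne] at h1
      apply WithConv.ofConv_injective
      exact h1.symm
  exact congr($h b)

instance (f : B →ₐc[ℂ] A) : (kerIdeal f).IsHopfIdeal ℂ where
  counit_eq_zero := by
    intro x hx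
    have : kerIdeal f ≤ RingHom.ker (Bialgebra.counitAlgHom ℂ A) := by
      rw [kerIdeal, Ideal.map_le_iff_le_comap]
      intro b hb
      simpa [RingHom.mem_ker] using hb
    exact this hx
  map_mkQ_comul_eq_zero := by
    intro x hx
    let q := Ideal.Quotient.mkₐ ℂ (kerIdeal f)
    have : kerIdeal f ≤ RingHom.ker
        ((Algebra.TensorProduct.map q q).comp (Bialgebra.comulAlgHom ℂ A)) := by
      refine Ideal.map_le_iff_le_comap.2 ?_
      intro b hb
      have hq : q.toLinearMap ∘ₗ (f : B →ₐ[ℂ] A).toLinearMap =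
          Algebra.linearMap ℂ (A ⧸ kerIdeal f) ∘ₗ Coalgebra.counit (R := ℂ) (A := B) := by
        ext b
        exact mk_apply_kerIdeal f b
      have hc : Coalgebra.comul (R := ℂ) (f b) =
          TensorProduct.map (f : B →ₐ[ℂ] A).toLinearMap (f : B →ₐ[ℂ] A).toLinearMap
            (Coalgebra.comul (R := ℂ) b) := (CoalgHomClass.map_comp_comul_apply f b).symm
      have hb' : Coalgebra.counit (R := ℂ) b = 0 := by simpa [RingHom.mem_ker] using hb
      change TensorProduct.map q.toLinearMap q.toLinearMap (Coalgebra.comul (R := ℂ) (f b)) = 0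
      rw [hc, ← LinearMap.comp_apply, ← TensorProduct.map_comp, hq, TensorProduct.map_comp,
        LinearMap.comp_apply]
      have h3 : TensorProduct.map (Coalgebra.counit (R := ℂ) (A := B))
          (Coalgebra.counit (R := ℂ) (A := B)) (Coalgebra.comul (R := ℂ) b) = 0 := by
        rw [← LinearMap.lTensor_comp_rTensor, LinearMap.comp_apply,
          Coalgebra.rTensor_counit_comul, LinearMap.lTensor_tmul, hb', TensorProduct.tmul_zero]
      rw [h3, map_zero]
    exact this hx
  antipode_mem := by
    intro x hx
    have : kerIdeal f ≤ (kerIdeal f).comap (HopfAlgebra.antipodeAlgHom ℂ A) := by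
      refine Ideal.map_le_iff_le_comap.2 ?_
      intro b hb
      have h2 : HopfAlgebra.antipode ℂ (f b) ∈ kerIdeal f := by
        rw [map_antipode]
        refine Ideal.mem_map_of_mem (f : B →ₐ[ℂ] A) ?_
        simpa [RingHom.mem_ker] using hb
      exact h2
    exact this hx

/-- The coordinate ring of the kernel of the morphism of affine group schemes `Spec A → Spec B`
given by `f : B → A`. -/
abbrev KerAlg (f : B →ₐc[ℂ] A) : Type u := A ⧸ kerIdeal f

end AffineGroups

/-! ### The pro-reductive completion of a group -/

section Completion

variable (H : Type u) [Group H]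

variable {H} in
/-- The coefficients `h ↦ φ (ρ h v)` of finite-dimensional complex semisimple representations. -/
def IsSemisimpleCoefficient (f : H → ℂ) : Prop :=
  ∃ (n : ℕ) (ρ : Representation ℂ H (Fin n → ℂ)) (φ : Module.Dual ℂ (Fin n → ℂ)) (x : Fin n → ℂ),
    ρ.IsSemisimpleRepresentation ∧ ∀ h, f h = φ (ρ h x)

/-- The coordinate ring of the pro-reductive completion (Tannaka closure) of `H`: the algebra of
representation functions of `H`, generated by the coefficients of semisimple representations.
(A tensor product of semisimple complex representations is semisimple, so products of
coefficients are again coefficients and the algebra is just the set of all coefficients.) -/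
def repAlg : Subalgebra ℂ (H → ℂ) :=
  Algebra.adjoin ℂ {f | IsSemisimpleCoefficient f}

variable {H}

lemma semisimple_iff {V : Type v} [AddCommGroup V] [Module ℂ V] (ρ : Representation ℂ H V) :
    ρ.IsSemisimpleRepresentation ↔ ∀ W : Submodule ℂ V, (∀ h, ∀ w ∈ W, ρ h w ∈ W) →
      ∃ W' : Submodule ℂ V, (∀ h, ∀ w ∈ W', ρ h w ∈ W') ∧ IsCompl W W' := by
  constructor
  · intro hρ W hW
    obtain ⟨S, hS⟩ := hρ.exists_isCompl ⟨W, hW⟩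
    refine ⟨S.toSubmodule, S.apply_mem_toSubmodule, ?_, ?_⟩
    · have := congrArg Subrepresentation.toSubmodule hS.inf_eq_bot
      rw [Subrepresentation.toSubmodule_inf] at this
      exact disjoint_iff.2 this
    · have := congrArg Subrepresentation.toSubmodule hS.sup_eq_top
      rw [Subrepresentation.toSubmodule_sup] at this
      exact codisjoint_iff.2 this
  · intro h
    refine ⟨fun S => ?_⟩
    obtain ⟨W', hW', hc⟩ := h S.toSubmodule S.apply_mem_toSubmodule
    refine ⟨⟨W', hW'⟩, disjoint_iff.2 ?_, codisjoint_iff.2 ?_⟩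
    · apply Subrepresentation.toSubmodule_injective
      rw [Subrepresentation.toSubmodule_inf]
      exact hc.inf_eq_bot
    · apply Subrepresentation.toSubmodule_injective
      rw [Subrepresentation.toSubmodule_sup]
      exact hc.sup_eq_top

lemma isSemisimpleCoefficient_of {V : Type v} [AddCommGroup V] [Module ℂ V]
    [FiniteDimensional ℂ V] (ρ : Representation ℂ H V) (hρ : ρ.IsSemisimpleRepresentation)
    (φ : Module.Dual ℂ V) (x : V) : IsSemisimpleCoefficient fun h => φ (ρ h x) := by
  let e : V ≃ₗ[ℂ] (Fin (Module.finrank ℂ V) → ℂ) := (Module.finBasis ℂ V).equivFun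
  let ρ' : Representation ℂ H (Fin (Module.finrank ℂ V) → ℂ) :=
    { toFun := fun h => e.toLinearMap ∘ₗ ρ h ∘ₗ e.symm.toLinearMap
      map_one' := by ext; simp
      map_mul' := fun a b => by ext; simp }
  have hρ' : ∀ h y, ρ' h y = e (ρ h (e.symm y)) := fun _ _ => rfl
  refine ⟨_, ρ', φ ∘ₗ e.symm.toLinearMap, e x, ?_, ?_⟩
  · rw [semisimple_iff] at hρ ⊢
    intro W hW
    obtain ⟨W', hW', hc⟩ := hρ (W.comap e.toLinearMap) (fun h w hw => by
      have := hW h _ hw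
      simpa [hρ'] using this)
    refine ⟨W'.map e.toLinearMap, ?_, ?_⟩
    · rintro h _ ⟨w, hw, rfl⟩
      exact ⟨ρ h w, hW' h w hw, by simp [hρ']⟩
    · have h2 := (Submodule.orderIsoMapComap e).isCompl hc
      have h3 : (W.comap e.toLinearMap).map e.toLinearMap = W :=
        Submodule.map_comap_eq_of_surjective e.surjective W
      have h4 : IsCompl ((W.comap e.toLinearMap).map e.toLinearMap) (W'.map e.toLinearMap) := h2
      rwa [h3] at h4
  · intro h
    simp [hρ']

lemma semisimple_dual {V : Type v} [AddCommGroup V] [Module ℂ V]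
    [FiniteDimensional ℂ V] (ρ : Representation ℂ H V) (hρ : ρ.IsSemisimpleRepresentation) :
    ρ.dual.IsSemisimpleRepresentation := by
  rw [semisimple_iff] at hρ ⊢
  intro W hW
  obtain ⟨C, hC, hc⟩ := hρ W.dualCoannihilator (fun h w hw => by
    rw [Submodule.mem_dualCoannihilator] at hw ⊢
    intro φ hφ
    have := hw _ (hW h⁻¹ φ hφ)
    simpa [Representation.dual_apply, Module.Dual.transpose_apply] using this)
  refine ⟨C.dualAnnihilator, ?_, ?_⟩
  · intro h φ hφ
    rw [Submodule.mem_dualAnnihilator] at hφ ⊢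
    intro w hw
    have := hφ _ (hC h⁻¹ w hw)
    simpa [Representation.dual_apply, Module.Dual.transpose_apply] using this
  · have h1 : W.dualCoannihilator.dualAnnihilator = W :=
      Subspace.dualCoannihilator_dualAnnihilator_eq
    rw [← h1]
    refine ⟨?_, ?_⟩
    · rw [disjoint_iff, ← Submodule.dualAnnihilator_sup_eq, hc.sup_eq_top]
      simp
    · rw [codisjoint_iff, ← Subspace.dualAnnihilator_inf_eq, hc.inf_eq_bot]
      simp

/-- Evaluation at an element of the group. -/
def evalAt (h : H) : repAlg H →ₐ[ℂ] ℂ := (Pi.evalAlgHom ℂ (fun _ : H => ℂ) h).comp (repAlg H).val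

@[simp] lemma evalAt_apply (h : H) (f : repAlg H) : evalAt h f = f.1 h := rfl

lemma tensor_separated {ι κ V W : Type*} [AddCommGroup V] [Module ℂ V]
    [AddCommGroup W] [Module ℂ W] (e : ι → V →ₗ[ℂ] ℂ) (g : κ → W →ₗ[ℂ] ℂ)
    (he : ∀ x, (∀ i, e i x = 0) → x = 0) (hg : ∀ x, (∀ i, g i x = 0) → x = 0)
    (t : V ⊗[ℂ] W)
    (ht : ∀ i j, TensorProduct.lid ℂ ℂ (TensorProduct.map (e i) (g j) t) = 0) : t = 0 := by
  classical
  let b := Module.Basis.ofVectorSpace ℂ W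
  have h1 : ∀ i, TensorProduct.lid ℂ W ((e i).rTensor W t) = 0 := by
    intro i
    apply hg
    intro j
    rw [← ht i j]
    clear ht
    induction t with
    | zero => simp
    | tmul x y => simp
    | add x y hx hy => simp only [map_add, hx, hy]
  apply (TensorProduct.equivFinsuppOfBasisRight (M := V) b).injective
  rw [map_zero]
  ext k
  apply he
  intro i
  rw [TensorProduct.equivFinsuppOfBasisRight_apply]
  have h2 : e i (TensorProduct.rid ℂ V ((b.coord k).lTensor V t)) =
      b.coord k (TensorProduct.lid ℂ W ((e i).rTensor W t)) := by
    clear ht h1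
    induction t with
    | zero => simp
    | tmul x y => simp [mul_comm]
    | add x y hx hy => simp only [map_add, hx, hy]
  rw [h2, h1, map_zero]

/-- `a ⊗ b ↦ a h * b k`. -/
def evalAt₂ (h k : H) : repAlg H ⊗[ℂ] repAlg H →ₐ[ℂ] ℂ :=
  Algebra.TensorProduct.lift (evalAt h) (evalAt k) (fun _ _ => Commute.all _ _)

@[simp] lemma evalAt₂_tmul (h k : H) (a b : repAlg H) :
    evalAt₂ h k (a ⊗ₜ b) = a.1 h * b.1 k := by simp [evalAt₂]

instance : AddCommGroup (repAlg H ⊗[ℂ] repAlg H) := TensorProduct.addCommGroup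

instance : AddCommGroup (repAlg H ⊗[ℂ] (repAlg H ⊗[ℂ] repAlg H)) := TensorProduct.addCommGroup

lemma eq_zero_of_evalAt (f : repAlg H) (hf : ∀ h, evalAt h f = 0) : f = 0 :=
  Subtype.ext (funext hf)

lemma eq_zero_of_evalAt₂ (t : repAlg H ⊗[ℂ] repAlg H) (ht : ∀ h k, evalAt₂ h k t = 0) :
    t = 0 := by
  refine tensor_separated (fun h : H => (evalAt h).toLinearMap)
    (fun h : H => (evalAt h).toLinearMap) eq_zero_of_evalAt eq_zero_of_evalAt t ?_
  intro h k
  rw [← ht h k]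
  clear ht
  induction t with
  | zero => simp
  | tmul x y => simp
  | add x y hx hy => simp only [map_add, hx, hy]

/-- `a ⊗ b` as the function `(h, k) ↦ a h * b k`. -/
def tensorEval : repAlg H ⊗[ℂ] repAlg H →ₐ[ℂ] (H × H → ℂ) :=
  AlgHom.pi fun p => evalAt₂ p.1 p.2

lemma tensorEval_injective : Function.Injective (tensorEval (H := H)) := by
  rw [injective_iff_map_eq_zero]
  intro t ht
  exact eq_zero_of_evalAt₂ t fun h k => congrFun ht (h, k)

/-- `f` as the function `(h, k) ↦ f (h * k)`. -/
def mulPull (H : Type u) [Group H] : (H → ℂ) →ₐ[ℂ] (H × H → ℂ) :=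
  AlgHom.pi fun p => Pi.evalAlgHom ℂ (fun _ : H => ℂ) (p.1 * p.2)

/-- `f` as the function `h ↦ f h⁻¹`. -/
def invPull (H : Type u) [Group H] : (H → ℂ) →ₐ[ℂ] (H → ℂ) :=
  AlgHom.pi fun h => Pi.evalAlgHom ℂ (fun _ : H => ℂ) h⁻¹

lemma mulPull_mem (f : repAlg H) : mulPull H f.1 ∈ (tensorEval (H := H)).range := by
  have : repAlg H ≤ (tensorEval (H := H)).range.comap (mulPull H) := by
    refine Algebra.adjoin_le ?_
    rintro f ⟨n, ρ, φ, x, hρ, hf⟩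
    refine ⟨∑ i, (⟨fun h => φ (ρ h (Pi.single i 1)), Algebra.subset_adjoin
        (isSemisimpleCoefficient_of ρ hρ _ _)⟩ : repAlg H) ⊗ₜ
      (⟨fun h => LinearMap.proj i (ρ h x), Algebra.subset_adjoin
        (isSemisimpleCoefficient_of ρ hρ (LinearMap.proj i) x)⟩ : repAlg H), ?_⟩
    rw [map_sum]
    ext ⟨h, k⟩
    have h1 : ρ k x = ∑ i, (ρ k x i) • (Pi.single i 1 : Fin n → ℂ) := by
      simpa using (pi_eq_sum_univ' (ρ k x))
    have h2 : mulPull H f (h, k) = φ (ρ h (ρ k x)) := by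
      simp [mulPull, hf]
    refine Eq.trans ?_ h2.symm
    rw [h1]
    simp [tensorEval, mul_comm]
  exact this f.2

lemma invPull_mem (f : repAlg H) : invPull H f.1 ∈ repAlg H := by
  have : repAlg H ≤ (repAlg H).comap (invPull H) := by
    refine Algebra.adjoin_le ?_
    rintro f ⟨n, ρ, φ, x, hρ, hf⟩
    refine Algebra.subset_adjoin ?_
    have := isSemisimpleCoefficient_of ρ.dual (semisimple_dual ρ hρ)
      (Module.Dual.eval ℂ (Fin n → ℂ) x) φ
    have h2 : invPull H f = fun h => Module.Dual.eval ℂ (Fin n → ℂ) x (ρ.dual h φ) := by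
      ext h
      simp [invPull, hf, Representation.dual_apply, Module.Dual.transpose_apply]
    exact h2 ▸ this
  exact this f.2

/-- The comultiplication of `repAlg H`: the element of `repAlg H ⊗ repAlg H` which corresponds to
the function `(h, k) ↦ f (h * k)`. -/
def repComul : repAlg H →ₐ[ℂ] repAlg H ⊗[ℂ] repAlg H :=
  (AlgEquiv.ofInjective tensorEval tensorEval_injective).symm.toAlgHom.comp
    (((mulPull H).comp (repAlg H).val).codRestrict (tensorEval (H := H)).range mulPull_mem)

lemma evalAt₂_repComul (h k : H) (f : repAlg H) : evalAt₂ h k (repComul f) = f.1 (h * k) := by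
  have : tensorEval (repComul f) = mulPull H f.1 :=
    congrArg Subtype.val ((AlgEquiv.ofInjective tensorEval tensorEval_injective).apply_symm_apply
      ((((mulPull H).comp (repAlg H).val).codRestrict (tensorEval (H := H)).range mulPull_mem) f))
  exact congrFun this (h, k)

/-- The antipode of `repAlg H`: `f ↦ (h ↦ f h⁻¹)`. -/
def repAntipode : repAlg H →ₐ[ℂ] repAlg H :=
  ((invPull H).comp (repAlg H).val).codRestrict (repAlg H) invPull_mem

lemma repAntipode_apply (f : repAlg H) (h : H) : (repAntipode f).1 h = f.1 h⁻¹ := rfl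

lemma evalAt₂_comp_repComul (h k : H) : (evalAt₂ h k).comp repComul = evalAt (h * k) :=
  AlgHom.ext (evalAt₂_repComul h k)

lemma algHom_ext_evalAt {R : Type v} [Semiring R] [Algebra ℂ R] {f g : R →ₐ[ℂ] repAlg H}
    (hfg : ∀ h, (evalAt h).comp f = (evalAt h).comp g) : f = g :=
  AlgHom.ext fun x => Subtype.ext (funext fun h => DFunLike.congr_fun (hfg h) x)

/-- `a ⊗ (b ⊗ c) ↦ a h * (b k * c l)`. -/
def evalAt₃ (h k l : H) : repAlg H ⊗[ℂ] (repAlg H ⊗[ℂ] repAlg H) →ₐ[ℂ] ℂ :=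
  Algebra.TensorProduct.lift (evalAt h) (evalAt₂ k l) (fun _ _ => Commute.all _ _)

set_option synthInstance.maxHeartbeats 200000 in
lemma eq_zero_of_evalAt₃ (t : repAlg H ⊗[ℂ] (repAlg H ⊗[ℂ] repAlg H))
    (ht : ∀ h k l, evalAt₃ h k l t = 0) : t = 0 := by
  refine tensor_separated (fun h : H => (evalAt h).toLinearMap)
    (fun p : H × H => (evalAt₂ p.1 p.2).toLinearMap) eq_zero_of_evalAt
    (fun x hx => eq_zero_of_evalAt₂ x fun h k => hx (h, k)) t ?_
  intro h p
  rw [← ht h p.1 p.2]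
  clear ht
  induction t with
  | zero => simp
  | tmul x y => simp [evalAt₃]
  | add x y hx hy => simp only [map_add, hx, hy]

set_option synthInstance.maxHeartbeats 200000 in
lemma algHom_ext_evalAt₃ {R : Type v} [Semiring R] [Algebra ℂ R]
    {f g : R →ₐ[ℂ] repAlg H ⊗[ℂ] (repAlg H ⊗[ℂ] repAlg H)}
    (hfg : ∀ h k l, (evalAt₃ h k l).comp f = (evalAt₃ h k l).comp g) : f = g :=
  AlgHom.ext fun x => sub_eq_zero.1 <| eq_zero_of_evalAt₃ _ fun h k l => by
    rw [map_sub, sub_eq_zero]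
    exact DFunLike.congr_fun (hfg h k l) x

lemma repComul_coassoc :
    (Algebra.TensorProduct.assoc ℂ ℂ ℂ (repAlg H) (repAlg H) (repAlg H)).toAlgHom.comp
      ((Algebra.TensorProduct.map repComul (.id ℂ (repAlg H))).comp repComul) =
    (Algebra.TensorProduct.map (.id ℂ (repAlg H)) repComul).comp (repComul (H := H)) := by
  apply algHom_ext_evalAt₃
  intro h k l
  have h1 : ((evalAt₃ h k l).comp
      (Algebra.TensorProduct.assoc ℂ ℂ ℂ (repAlg H) (repAlg H) (repAlg H)).toAlgHom).comp
      (Algebra.TensorProduct.map repComul (.id ℂ (repAlg H))) = evalAt₂ (h * k) l := by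
    have h0 : (evalAt₃ h k l).comp
        (Algebra.TensorProduct.assoc ℂ ℂ ℂ (repAlg H) (repAlg H) (repAlg H)).toAlgHom =
        Algebra.TensorProduct.lift (evalAt₂ h k) (evalAt l) (fun _ _ => Commute.all _ _) := by
      ext x
      · simp [evalAt₃]
      · simp [evalAt₃]
      · simp [evalAt₃, Algebra.TensorProduct.one_def]
    rw [h0]
    ext x
    · simp [evalAt₂_repComul]
    · simp
  have h2 : (evalAt₃ h k l).comp
      (Algebra.TensorProduct.map (.id ℂ (repAlg H)) repComul) = evalAt₂ h (k * l) := by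
    ext x
    · simp [evalAt₃]
    · simp [evalAt₃, evalAt₂_repComul]
  rw [← AlgHom.comp_assoc, ← AlgHom.comp_assoc, h1, ← AlgHom.comp_assoc, h2,
    evalAt₂_comp_repComul, evalAt₂_comp_repComul, mul_assoc]

instance : Bialgebra ℂ (repAlg H) := by
  refine .ofAlgHom repComul (evalAt 1) repComul_coassoc ?_ ?_
  · apply AlgHom.ext
    intro f
    apply (Algebra.TensorProduct.lid ℂ (repAlg H)).injective
    refine Eq.trans ?_ ((Algebra.TensorProduct.lid ℂ (repAlg H)).apply_symm_apply f).symm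
    have : (Algebra.TensorProduct.lid ℂ (repAlg H)).toAlgHom.comp
        ((Algebra.TensorProduct.map (evalAt 1) (.id ℂ (repAlg H))).comp repComul) =
        AlgHom.id ℂ (repAlg H) := by
      apply algHom_ext_evalAt
      intro h
      have h1 : ((evalAt h).comp (Algebra.TensorProduct.lid ℂ (repAlg H)).toAlgHom).comp
          (Algebra.TensorProduct.map (evalAt 1) (.id ℂ (repAlg H))) = evalAt₂ 1 h := by
        ext <;> simp [evalAt₂]
      rw [← AlgHom.comp_assoc, ← AlgHom.comp_assoc, h1, evalAt₂_comp_repComul, one_mul]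
      rfl
    exact DFunLike.congr_fun this f
  · apply AlgHom.ext
    intro f
    apply (Algebra.TensorProduct.rid ℂ ℂ (repAlg H)).injective
    refine Eq.trans ?_ ((Algebra.TensorProduct.rid ℂ ℂ (repAlg H)).apply_symm_apply f).symm
    have : (Algebra.TensorProduct.rid ℂ ℂ (repAlg H)).toAlgHom.comp
        ((Algebra.TensorProduct.map (.id ℂ (repAlg H)) (evalAt 1)).comp repComul) =
        AlgHom.id ℂ (repAlg H) := by
      apply algHom_ext_evalAt
      intro h
      have h1 : ((evalAt h).comp (Algebra.TensorProduct.rid ℂ ℂ (repAlg H)).toAlgHom).comp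
          (Algebra.TensorProduct.map (.id ℂ (repAlg H)) (evalAt 1)) = evalAt₂ h 1 := by
        ext <;> simp [evalAt₂]
      rw [← AlgHom.comp_assoc, ← AlgHom.comp_assoc, h1, evalAt₂_comp_repComul, mul_one]
      rfl
    exact DFunLike.congr_fun this f

lemma comulAlgHom_repAlg : Bialgebra.comulAlgHom ℂ (repAlg H) = repComul := rfl

lemma counitAlgHom_repAlg : Bialgebra.counitAlgHom ℂ (repAlg H) = evalAt 1 := rfl

instance : HopfAlgebra ℂ (repAlg H) := by
  refine .ofAlgHom repAntipode ?_ ?_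
  · rw [comulAlgHom_repAlg, counitAlgHom_repAlg]
    apply algHom_ext_evalAt
    intro h
    have h1 : (evalAt h).comp (Algebra.TensorProduct.lift repAntipode (.id ℂ (repAlg H))
        fun _ _ => Commute.all _ _) = evalAt₂ h⁻¹ h := by
      ext <;> simp [evalAt₂, repAntipode_apply]
    rw [← AlgHom.comp_assoc, h1, evalAt₂_comp_repComul, inv_mul_cancel]
    rfl
  · rw [comulAlgHom_repAlg, counitAlgHom_repAlg]
    apply algHom_ext_evalAt
    intro h
    have h1 : (evalAt h).comp (Algebra.TensorProduct.lift (.id ℂ (repAlg H)) repAntipode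
        fun _ _ => Commute.all _ _) = evalAt₂ h h⁻¹ := by
      ext <;> simp [evalAt₂, repAntipode_apply]
    rw [← AlgHom.comp_assoc, h1, evalAt₂_comp_repComul, mul_inv_cancel]
    rfl

variable (H) in
/-- The canonical homomorphism from `H` to the complex points of its pro-reductive completion. -/
def toCompletion : H →* Points (repAlg H) where
  toFun h := WithConv.toConv (evalAt h)
  map_one' := by
    apply WithConv.ext
    rfl
  map_mul' h k := by
    apply WithConv.ext
    rw [AlgHom.convMul_def]
    refine Eq.trans (evalAt₂_comp_repComul h k).symm ?_
    have : evalAt₂ h k = (Algebra.TensorProduct.lmul' ℂ).comp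
        (Algebra.TensorProduct.map (evalAt h) (evalAt k)) := by
      ext <;> simp [evalAt₂]
    rw [this]
    rfl

/-- An affine group scheme with coordinate ring `A`, together with a homomorphism `ι` from `H` to
its complex points, is a pro-reductive completion of `H` if it is isomorphic, compatibly with the
homomorphisms from `H`, to the affine group scheme with coordinate ring `repAlg H`. -/
def IsProReductiveCompletion {A : Type v} [CommRing A] [HopfAlgebra ℂ A] (ι : H →* Points A) :
    Prop :=
  ∃ e : repAlg H ≃ₐc[ℂ] A, ∀ (h : H) (f : repAlg H), ι h (e f) = toCompletion H h f

/-- A character `χ : Spec (repAlg H) → 𝔾ₘ` of the pro-reductive completion of `H` extends the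
unitary character `χ'` of `H`; `T 1` is the coordinate function of `𝔾ₘ`. -/
def ExtendsCharacter (χ : LaurentPolynomial ℂ →ₐc[ℂ] repAlg H) (χ' : H →* Circle) : Prop :=
  ∀ h : H, toCompletion H h (χ (LaurentPolynomial.T 1)) = (χ' h : ℂ)

end Completion

end ProReductive

end

open ProReductive

/-!
Write `H = π₁(X)`, `N = π₁(Y)` and `j : N → H` for the induced homomorphism. It is injective because
`p` is a covering map, and its image is the kernel of `χ'`, a normal subgroup of finite index. The
statement is then about restriction of representation functions along `j`.

* Restriction maps `repAlg H` to `repAlg N` by Clifford's theorem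
  (`isSemisimpleRepresentation_restrict`).
* It is surjective (`restrictAlgHom_surjective`). A semisimple representation of `N` coinduces to a
  semisimple representation of `H`: on `N` the coinduced representation embeds into a product of
  conjugates, and semisimplicity passes up a subgroup of finite index by averaging. The
  extension by zero of a coefficient on `N` is a coefficient of the coinduced representation
  (`exists_extension_of_isSemisimpleCoefficient`).
* Its kernel is the ideal of `K = ker χ` (`mem_kerIdeal_iff`): with `m` the order of `χ'`, the
  indicator function of the image of `N` is the polynomial `m⁻¹ ∑ χ' ^ i` in `χ'`, so functions
  vanishing on `N` are multiples of `χ' - 1`.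

Hence `KerAlg χ ≃ repAlg N` (`exists_kerAlg_bialgEquiv`), and `K` is the pro-reductive completion of
`N`. The other two assertions hold for any pro-reductive completion. Both rest on the fact that, for
a Zariski dense homomorphism from `N` to the points of an affine group scheme, the representations
of `N` that extend to the group scheme are those whose coefficients are functions on it, and the
extension is unique (`ZariskiDense.existsUnique_algRep`). For a reductive group with coordinate ring
`B` this fact, applied to the span of the translates of a function, shows that elements of `B`
restrict to semisimple coefficients on `N` (`ZariskiDense.isSemisimpleCoefficient`), which gives the
map `B → repAlg N`.
-/

namespace ProReductive

universe u v w

/-! ### Semisimple representations and normal subgroups of finite index -/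

section Semisimple

variable {H : Type u} [Group H] {V : Type v} [AddCommGroup V] [Module ℂ V]

lemma isSemisimpleRepresentation_comp_of_surjective {N : Type w} [Group N]
    (ρ : Representation ℂ H V) (hρ : ρ.IsSemisimpleRepresentation) (c : N →* H)
    (hc : Function.Surjective c) :
    Representation.IsSemisimpleRepresentation (ρ.comp c : Representation ℂ N V) := by
  rw [semisimple_iff] at hρ ⊢
  intro W hW
  obtain ⟨W', hW', hcompl⟩ := hρ W fun h => by
    obtain ⟨n, rfl⟩ := hc h
    exact hW n
  exact ⟨W', fun n => hW' (c n), hcompl⟩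

/-- A representation which embeds into a finite product of semisimple representations is
semisimple. -/
lemma isSemisimpleRepresentation_of_injective {κ : Type*} [Finite κ] {W : κ → Type*}
    [∀ i, AddCommGroup (W i)] [∀ i, Module ℂ (W i)] (ρ : Representation ℂ H V)
    (τ : ∀ i, Representation ℂ H (W i)) (hτ : ∀ i, (τ i).IsSemisimpleRepresentation)
    (L : ∀ i, V →ₗ[ℂ] W i) (hL : ∀ i h x, L i (ρ h x) = τ i h (L i x))
    (hinj : ∀ x, (∀ i, L i x = 0) → x = 0) : ρ.IsSemisimpleRepresentation := by
  simp only [Representation.isSemisimpleRepresentation_iff_isSemisimpleModule_asModule] at hτ ⊢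
  let F : ∀ i, ρ.IntertwiningMap (τ i) := fun i => ⟨L i, fun h => LinearMap.ext (hL i h)⟩
  let Φ : ρ.asModule →ₗ[MonoidAlgebra ℂ H] ∀ i, (τ i).asModule :=
    LinearMap.pi fun i => Representation.IntertwiningMap.equivLinearMapAsModule ρ (τ i) (F i)
  refine IsSemisimpleModule.of_injective Φ ?_
  rw [injective_iff_map_eq_zero]
  intro x hx
  exact hinj x fun i => congrFun hx i

/-- A group of automorphisms of a complete modular atomic lattice all of whose fixed elements have
fixed complements forces the lattice to be complemented: the supremum of the atoms is fixed, and a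
fixed complement of it contains no atom. -/
lemma complementedLattice_of_fixed {L : Type*} [CompleteLattice L] [IsModularLattice L]
    [IsCompactlyGenerated L] [IsAtomic L] {ι : Type*} (φ : ι → L ≃o L)
    (h : ∀ a, (∀ i, φ i a = a) → ∃ b, IsCompl a b) : ComplementedLattice L := by
  refine complementedLattice_of_sSup_atoms_eq_top ?_
  obtain ⟨b, hb⟩ := h (sSup {a | IsAtom a}) fun i => by
    rw [OrderIso.map_sSup_eq_sSup_symm_preimage]
    congr 1
    ext a
    simp
  rcases eq_bot_or_exists_atom_le b with rfl | ⟨a, ha, hab⟩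
  · simpa using hb.sup_eq_top
  · exact absurd (le_bot_iff.1 (hb.disjoint (le_sSup ha) hab)) ha.1

/-- The translation `W ↦ ρ h⁻¹ W`, written as a preimage under `ρ h`, as an automorphism of
the lattice of subrepresentations of the restriction to a normal subgroup. -/
def translateSubrep (S : Subgroup H) [S.Normal] (ρ : Representation ℂ H V) (h : H) :
    Subrepresentation (ρ.comp S.subtype : Representation ℂ S V) ≃o
      Subrepresentation (ρ.comp S.subtype : Representation ℂ S V) where
  toFun W := ⟨W.toSubmodule.comap (ρ h), fun s w hw => by
    have := W.apply_mem_toSubmodule (MulAut.conjNormal h s) hw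
    simpa [← Module.End.mul_apply, ← map_mul] using this⟩
  invFun W := ⟨W.toSubmodule.comap (ρ h⁻¹), fun s w hw => by
    have := W.apply_mem_toSubmodule (MulAut.conjNormal h⁻¹ s) hw
    simpa [← Module.End.mul_apply, ← map_mul] using this⟩
  left_inv W := by
    apply Subrepresentation.toSubmodule_injective
    ext x
    simp [← Module.End.mul_apply, ← map_mul]
  right_inv W := by
    apply Subrepresentation.toSubmodule_injective
    ext x
    simp [← Module.End.mul_apply, ← map_mul]
  map_rel_iff' {W W'} := by
    constructor
    · intro hle x hx
      have := @hle (ρ h⁻¹ x) (by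
        change ρ h (ρ h⁻¹ x) ∈ W.toSubmodule
        simpa [← Module.End.mul_apply, ← map_mul] using show x ∈ W.toSubmodule from hx)
      change ρ h (ρ h⁻¹ x) ∈ W'.toSubmodule at this
      change x ∈ W'.toSubmodule
      simpa [← Module.End.mul_apply, ← map_mul] using this
    · intro hle x hx
      exact hle (show ρ h x ∈ W from hx)

/-- Clifford's theorem: the restriction of a semisimple representation to a normal subgroup is
semisimple. -/
lemma isSemisimpleRepresentation_restrict [FiniteDimensional ℂ V] (S : Subgroup H) [S.Normal]
    (ρ : Representation ℂ H V) (hρ : ρ.IsSemisimpleRepresentation) :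
    Representation.IsSemisimpleRepresentation (ρ.comp S.subtype : Representation ℂ S V) := by
  set σ : Representation ℂ S V := ρ.comp S.subtype with hσ
  rw [semisimple_iff] at hρ
  let e := Subrepresentation.subrepresentationSubmoduleOrderIso (ρ := σ)
  have : IsArtinian (MonoidAlgebra ℂ S) σ.asModule := isArtinian_of_tower ℂ inferInstance
  rw [Representation.isSemisimpleRepresentation_iff_isSemisimpleModule_asModule,
    isSemisimpleModule_iff]
  refine complementedLattice_of_fixed (ι := H)
    (fun h => (e.symm.trans (translateSubrep S ρ h)).trans e) ?_
  intro a ha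
  have ha' : ∀ h, translateSubrep S ρ h (e.symm a) = e.symm a := fun h => by
    rw [← e.symm_apply_apply (translateSubrep S ρ h (e.symm a))]
    exact congrArg e.symm (ha h)
  obtain ⟨C, hC, hc⟩ := hρ (e.symm a).toSubmodule fun h w hw => by
    rw [← ha' h] at hw
    exact hw
  let C' : Subrepresentation σ := ⟨C, fun s w hw => hC s w hw⟩
  have hc' : IsCompl (e.symm a) C' := by
    refine ⟨disjoint_iff.2 ?_, codisjoint_iff.2 ?_⟩
    · apply Subrepresentation.toSubmodule_injective
      rw [Subrepresentation.toSubmodule_inf]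
      exact hc.inf_eq_bot
    · apply Subrepresentation.toSubmodule_injective
      rw [Subrepresentation.toSubmodule_sup]
      exact hc.sup_eq_top
  refine ⟨e C', ?_⟩
  simpa using e.isCompl hc'

/-- The converse of Clifford's theorem for subgroups of finite index, by averaging a projection
over the cosets. -/
lemma isSemisimpleRepresentation_of_restrict (S : Subgroup H) [S.FiniteIndex]
    (ρ : Representation ℂ H V)
    (hρ : Representation.IsSemisimpleRepresentation (ρ.comp S.subtype : Representation ℂ S V)) :
    ρ.IsSemisimpleRepresentation := by
  classical
  rw [semisimple_iff] at hρ ⊢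
  intro W hW
  obtain ⟨C, hC, hc⟩ := hρ W fun s => hW s
  let P : V →ₗ[ℂ] V := W.projection C hc
  have hPW : ∀ x, P x ∈ W := fun x => Submodule.projection_apply_mem hc x
  have hPid : ∀ x ∈ W, P x = x := fun x hx => Submodule.projection_apply_left hc ⟨x, hx⟩
  have hPS : ∀ s ∈ S, ∀ x, P (ρ s x) = ρ s (P x) := by
    intro s hs x
    have h1 : x = P x + (x - P x) := by abel
    have h2 : ρ s (x - P x) ∈ C := hC ⟨s, hs⟩ _ (Submodule.sub_projection_mem hc x)
    have h3 : P (ρ s (x - P x)) = 0 := (Submodule.projection_apply_eq_zero_iff hc).2 h2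
    conv_lhs => rw [h1]
    rw [map_add, map_add, h3, add_zero, hPid _ (hW s _ (hPW x))]
  -- The conjugates of `P` depend only on the coset since `P` commutes with `S`.
  let F : H ⧸ S → V →ₗ[ℂ] V := Quotient.lift (fun h : H => ρ h ∘ₗ P ∘ₗ ρ h⁻¹) (by
    intro a b hab
    have hab' : a⁻¹ * b ∈ S := QuotientGroup.leftRel_apply.1 hab
    ext x
    have := hPS _ hab' (ρ b⁻¹ x)
    have h4 : ρ b = ρ a * ρ (a⁻¹ * b) := by rw [← map_mul, mul_inv_cancel_left]
    simp only [LinearMap.comp_apply]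
    rw [h4, Module.End.mul_apply, ← this, ← Module.End.mul_apply (ρ (a⁻¹ * b)), ← map_mul,
      mul_assoc, mul_inv_cancel, mul_one])
  have hF : ∀ h : H, F (h : H ⧸ S) = ρ h ∘ₗ P ∘ₗ ρ h⁻¹ := fun _ => rfl
  have hFW : ∀ q x, F q x ∈ W := by
    intro q x
    induction q using QuotientGroup.induction_on with
    | H h => exact hW h _ (hPW _)
  have hFid : ∀ q, ∀ x ∈ W, F q x = x := by
    intro q x hx
    induction q using QuotientGroup.induction_on with
    | H h =>
      rw [hF, LinearMap.comp_apply, LinearMap.comp_apply, hPid _ (hW _ _ hx),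
        ← Module.End.mul_apply, ← map_mul]
      simp
  have hFH : ∀ (h : H) q x, F (h • q) (ρ h x) = ρ h (F q x) := by
    intro h q x
    induction q using QuotientGroup.induction_on with
    | H g =>
      rw [MulAction.Quotient.smul_coe, hF, hF]
      simp only [LinearMap.comp_apply, smul_eq_mul]
      rw [← Module.End.mul_apply (ρ (h * g)⁻¹), ← map_mul, ← Module.End.mul_apply (ρ h), ← map_mul]
      simp
  have : Fintype (H ⧸ S) := Fintype.ofFinite _
  have hcard : (Fintype.card (H ⧸ S) : ℂ) ≠ 0 := by
    exact_mod_cast Fintype.card_ne_zero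
  let A : V →ₗ[ℂ] V := (Fintype.card (H ⧸ S) : ℂ)⁻¹ • ∑ q, F q
  have hA : ∀ x, A x = (Fintype.card (H ⧸ S) : ℂ)⁻¹ • ∑ q, F q x := fun x => by
    simp [A, LinearMap.sum_apply]
  have hproj : LinearMap.IsProj W A := by
    refine ⟨fun x => ?_, fun x hx => ?_⟩
    · rw [hA]
      exact W.smul_mem _ (W.sum_mem fun q _ => hFW q x)
    · rw [hA, Finset.sum_congr rfl fun q _ => hFid q x hx, Finset.sum_const, Finset.card_univ,
        ← Nat.cast_smul_eq_nsmul ℂ, smul_smul, inv_mul_cancel₀ hcard, one_smul]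
  refine ⟨LinearMap.ker A, ?_, hproj.isCompl⟩
  intro h x hx
  rw [LinearMap.mem_ker] at hx ⊢
  have : A (ρ h x) = ρ h (A x) := by
    rw [hA, hA, map_smul, map_sum]
    congr 1
    rw [← (MulAction.bijective h).sum_comp (fun q => F q (ρ h x))]
    exact Finset.sum_congr rfl fun q _ => hFH h q x
  rw [this, hx, map_zero]

variable (S : Subgroup H) [S.Normal] (ρ : Representation ℂ S V)

lemma eq_zero_of_mem_coindV (F : Representation.coindV S.subtype ρ)
    (hF : ∀ q : H ⧸ S, F.1 q.out = 0) : F = 0 := by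
  apply Subtype.ext
  funext h
  have hS : h * ((h : H ⧸ S).out)⁻¹ ∈ S :=
    (inferInstance : S.Normal).mem_comm (QuotientGroup.eq.1 (QuotientGroup.out_eq' (h : H ⧸ S)))
  have := F.2 ⟨_, hS⟩ ((h : H ⧸ S).out)
  rw [hF, map_zero] at this
  simpa using this

lemma finiteDimensional_coindV [S.FiniteIndex] [FiniteDimensional ℂ V] :
    FiniteDimensional ℂ (Representation.coindV S.subtype ρ) := by
  let L : Representation.coindV S.subtype ρ →ₗ[ℂ] (H ⧸ S → V) :=
    (LinearMap.pi fun q : H ⧸ S => LinearMap.proj q.out) ∘ₗ Submodule.subtype _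
  refine FiniteDimensional.of_injective L ?_
  rw [injective_iff_map_eq_zero]
  exact fun F hF => eq_zero_of_mem_coindV S ρ F fun q => congrFun hF q

/-- Coinduction from a normal subgroup of finite index preserves semisimplicity: restricted to the
subgroup, the coinduced representation embeds into a product of conjugates of `ρ`. -/
lemma isSemisimpleRepresentation_coind [S.FiniteIndex] (hρ : ρ.IsSemisimpleRepresentation) :
    (Representation.coind S.subtype ρ).IsSemisimpleRepresentation := by
  refine isSemisimpleRepresentation_of_restrict S _ ?_
  refine isSemisimpleRepresentation_of_injective (κ := H ⧸ S) (W := fun _ => V) _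
    (fun q => ρ.comp (MulAut.conjNormal q.out : S ≃* S).toMonoidHom)
    (fun q => isSemisimpleRepresentation_comp_of_surjective ρ hρ _ (MulEquiv.surjective _))
    (fun q => LinearMap.proj q.out ∘ₗ Submodule.subtype _) ?_ (eq_zero_of_mem_coindV S ρ)
  intro q s F
  have := F.2 (MulAut.conjNormal q.out s) q.out
  change F.1 (q.out * s) = ρ (MulAut.conjNormal q.out s) (F.1 q.out)
  simpa using this

/-- The extension is by zero outside `S`, a coefficient of the coinduced representation. -/
lemma exists_extension_of_isSemisimpleCoefficient [S.FiniteIndex] (f : S → ℂ)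
    (hf : IsSemisimpleCoefficient f) :
    ∃ F : H → ℂ, IsSemisimpleCoefficient F ∧ ∀ s : S, F s = f s := by
  classical
  obtain ⟨n, ρ, φ, x, hρ, hf⟩ := hf
  have := finiteDimensional_coindV S ρ
  -- The element of the coinduced representation supported on `S` with value `x` at `1`.
  let F : Representation.coindV S.subtype ρ :=
    ⟨fun h => if hh : h ∈ S then ρ ⟨h, hh⟩ x else 0, fun s h => by
      by_cases hh : h ∈ S
      · have h1 : (s : H) * h ∈ S := S.mul_mem s.2 hh
        have h2 : (⟨s * h, h1⟩ : S) = s * ⟨h, hh⟩ := rfl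
        simp [hh, h1, h2]
      · have h1 : (s : H) * h ∉ S := by rwa [S.mul_mem_cancel_left s.2]
        simp [hh, h1]⟩
  refine ⟨fun h => φ ((LinearMap.proj 1 ∘ₗ Submodule.subtype _)
      (Representation.coind S.subtype ρ h F)),
    isSemisimpleCoefficient_of _ (isSemisimpleRepresentation_coind S ρ hρ)
      (φ ∘ₗ LinearMap.proj 1 ∘ₗ Submodule.subtype _) F, fun s => ?_⟩
  change φ (F.1 (1 * s)) = f s
  simp [F, hf]

end Semisimple

/-! ### Algebraic representations and Zariski dense homomorphisms -/

section AlgebraicRepresentations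

variable {A : Type u} [CommRing A] [HopfAlgebra ℂ A] {V : Type v} [AddCommGroup V] [Module ℂ V]

/-- Evaluation of the second factor of `V ⊗ A` at a complex point: `x ⊗ a ↦ g a • x`. -/
noncomputable def evalRight (V : Type v) [AddCommGroup V] [Module ℂ V] (g : Points A) :
    V ⊗[ℂ] A →ₗ[ℂ] V :=
  (TensorProduct.rid ℂ V).toLinearMap ∘ₗ g.ofConv.toLinearMap.lTensor V

@[simp] lemma evalRight_tmul (g : Points A) (x : V) (a : A) :
    evalRight V g (x ⊗ₜ a) = g a • x := by
  simp [evalRight]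

lemma evalRight_rTensor {W : Type w} [AddCommGroup W] [Module ℂ W] (f : V →ₗ[ℂ] W)
    (g : Points A) (t : V ⊗[ℂ] A) : evalRight W g (f.rTensor A t) = f (evalRight V g t) := by
  induction t with
  | zero => simp
  | tmul x a => simp
  | add x y hx hy => simp only [map_add, hx, hy]

lemma points_apply_lid_rTensor (φ : Module.Dual ℂ V) (g : Points A) (t : V ⊗[ℂ] A) :
    g (TensorProduct.lid ℂ A (φ.rTensor A t)) = φ (evalRight V g t) := by
  change g.ofConv _ = _
  induction t with
  | zero => simp
  | tmul x a =>
    simp only [LinearMap.rTensor_tmul, TensorProduct.lid_tmul, map_smul, evalRight_tmul,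
      smul_eq_mul]
    exact mul_comm _ _
  | add x y hx hy => simp only [map_add, hx, hy]

lemma AlgRep.act_apply (σ : AlgRep A V) (g : Points A) (x : V) :
    σ.act g x = evalRight V g (σ.coact x) := rfl

/-- The orbit of a vector under the points of a group scheme spans a finite-dimensional space; here
`t` stands for the coaction of the vector. -/
lemma exists_fg_evalRight_mem (t : V ⊗[ℂ] A) :
    ∃ W : Submodule ℂ V, W.FG ∧ ∀ g : Points A, evalRight V g t ∈ W := by
  induction t with
  | zero => exact ⟨⊥, Submodule.fg_bot, fun g => by simp⟩
  | tmul x a =>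
    refine ⟨ℂ ∙ x, Submodule.fg_span_singleton x, fun g => ?_⟩
    rw [evalRight_tmul]
    exact Submodule.smul_mem _ _ (Submodule.mem_span_singleton_self x)
  | add x y hx hy =>
    obtain ⟨W, hW, hx⟩ := hx
    obtain ⟨W', hW', hy⟩ := hy
    refine ⟨W ⊔ W', hW.sup hW', fun g => ?_⟩
    rw [map_add]
    exact Submodule.add_mem_sup (hx g) (hy g)

/-- `a ⊗ b ↦ g a * h b`. -/
noncomputable def evalPair (g h : Points A) : A ⊗[ℂ] A →ₗ[ℂ] ℂ :=
  LinearMap.mul' ℂ ℂ ∘ₗ TensorProduct.map g.ofConv.toLinearMap h.ofConv.toLinearMap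

@[simp] lemma evalPair_tmul (g h : Points A) (a b : A) : evalPair g h (a ⊗ₜ b) = g a * h b := rfl

lemma evalPair_comul (g h : Points A) (a : A) :
    evalPair g h (Coalgebra.comul (R := ℂ) a) = (g * h) a := by
  rw [AlgHom.convMul_apply]
  generalize Coalgebra.comul (R := ℂ) a = t
  induction t with
  | zero => simp
  | tmul x y => simp
  | add x y hx hy => simp only [map_add, hx, hy]

lemma evalPair_lTensor_comul (g h : Points A) (t : V ⊗[ℂ] A) :
    TensorProduct.rid ℂ V ((evalPair g h).lTensor V
      ((Coalgebra.comul (R := ℂ) (A := A)).lTensor V t)) = evalRight V (g * h) t := by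
  induction t with
  | zero => simp
  | tmul x a => simp [evalPair_comul]
  | add x y hx hy => simp only [map_add, hx, hy]

lemma evalPair_assoc_rTensor (g h : Points A) (f : V →ₗ[ℂ] V ⊗[ℂ] A) (t : V ⊗[ℂ] A) :
    TensorProduct.rid ℂ V ((evalPair g h).lTensor V
      (TensorProduct.assoc ℂ V A A (f.rTensor A t))) = evalRight V g (f (evalRight V h t)) := by
  induction t with
  | zero => simp
  | tmul x a =>
    rw [LinearMap.rTensor_tmul, evalRight_tmul, map_smul, map_smul]
    generalize f x = s
    induction s with
    | zero => simp
    | tmul y b => simp [smul_smul, mul_comm]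
    | add y z hy hz => simp only [TensorProduct.add_tmul, map_add, hy, hz, smul_add]
  | add x y hx hy => simp only [map_add, hx, hy]

lemma AlgRep.act_mul (σ : AlgRep A V) (g h : Points A) : σ.act (g * h) = σ.act g * σ.act h := by
  ext x
  rw [Module.End.mul_apply, AlgRep.act_apply, AlgRep.act_apply, AlgRep.act_apply,
    ← evalPair_lTensor_comul, ← evalPair_assoc_rTensor]
  congr 2
  exact (LinearMap.congr_fun σ.coassoc x).symm

lemma AlgRep.act_one (σ : AlgRep A V) : σ.act 1 = 1 :=
  σ.counit

/-- The representation of a group on the space of an algebraic representation, through a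
homomorphism to the group of complex points. -/
noncomputable def AlgRep.comp {N : Type w} [Group N] (σ : AlgRep A V) (ι : N →* Points A) :
    Representation ℂ N V where
  toFun n := σ.act (ι n)
  map_one' := by rw [map_one, σ.act_one]
  map_mul' m n := by rw [map_mul, σ.act_mul]

/-- The regular representation of an affine group scheme on its coordinate ring. -/
noncomputable def regularAlgRep (A : Type u) [CommRing A] [HopfAlgebra ℂ A] : AlgRep A A where
  coact := Coalgebra.comul
  coassoc := Coalgebra.coassoc
  counit := by
    ext x
    simp

lemma counit_act_regularAlgRep (g : Points A) (a : A) :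
    Coalgebra.counit (R := ℂ) ((regularAlgRep A).act g a) = g a := by
  rw [AlgRep.act_apply, ← points_apply_lid_rTensor]
  change g (TensorProduct.lid ℂ A (Coalgebra.counit.rTensor A (Coalgebra.comul (R := ℂ) a))) = _
  simp

variable {N : Type w} [Group N] {ι : N →* Points A}

lemma ZariskiDense.eq_zero_of_evalRight (hι : ZariskiDense ι) (t : V ⊗[ℂ] A)
    (ht : ∀ n, evalRight V (ι n) t = 0) : t = 0 := by
  refine tensor_separated (fun φ : Module.Dual ℂ V => φ)
    (fun n : N => (ι n).ofConv.toLinearMap)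
    (fun x hx => (Module.forall_dual_apply_eq_zero_iff ℂ x).1 hx) hι t ?_
  intro φ n
  refine Eq.trans ?_ (congrArg φ (ht n) |>.trans (map_zero φ))
  clear ht
  induction t with
  | zero => simp
  | tmul x y => simp [mul_comm]
  | add x y hx hy => simp only [map_add, hx, hy]

lemma ZariskiDense.eq_of_evalPair (hι : ZariskiDense ι) {s t : V ⊗[ℂ] (A ⊗[ℂ] A)}
    (h : ∀ m n, TensorProduct.rid ℂ V ((evalPair (ι m) (ι n)).lTensor V s) =
      TensorProduct.rid ℂ V ((evalPair (ι m) (ι n)).lTensor V t)) : s = t := by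
  rw [← sub_eq_zero]
  have h' : ∀ m n, TensorProduct.rid ℂ V ((evalPair (ι m) (ι n)).lTensor V (s - t)) = 0 := by
    intro m n
    rw [map_sub, map_sub, h, sub_self]
  generalize s - t = t at h'
  refine tensor_separated (fun φ : Module.Dual ℂ V => φ)
    (fun p : N × N => evalPair (ι p.1) (ι p.2))
    (fun x hx => (Module.forall_dual_apply_eq_zero_iff ℂ x).1 hx) ?_ t ?_
  · intro x hx
    refine tensor_separated (fun n : N => (ι n).ofConv.toLinearMap)
      (fun n : N => (ι n).ofConv.toLinearMap) hι hι x ?_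
    intro m n
    exact hx (m, n)
  · intro φ p
    refine Eq.trans ?_ (congrArg φ (h' p.1 p.2) |>.trans (map_zero φ))
    clear h h'
    induction t with
    | zero => simp
    | tmul x y => simp [mul_comm]
    | add x y hx hy => simp only [map_add, hx, hy]

/-- A representation of `N` all of whose coefficients are functions on `Spec A` extends uniquely
to `Spec A`, for a Zariski dense homomorphism from `N`. -/
lemma ZariskiDense.existsUnique_algRep [FiniteDimensional ℂ V] (hι : ZariskiDense ι)
    (ρ : Representation ℂ N V)
    (hρ : ∀ (φ : Module.Dual ℂ V) (x : V), ∃ a : A, ∀ n, ι n a = φ (ρ n x)) :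
    ∃! σ : AlgRep A V, ∀ n, σ.act (ι n) = ρ n := by
  choose c hc using hρ
  have hext : ∀ a b : A, (∀ n, ι n a = ι n b) → a = b := fun a b hab => by
    rw [← sub_eq_zero]
    exact hι _ fun n => (map_sub (ι n).ofConv a b).trans (sub_eq_zero.2 (hab n))
  -- The function with a given coefficient is unique by density, hence depends linearly on `x`.
  let C : Module.Dual ℂ V → V →ₗ[ℂ] A := fun φ =>
    { toFun := c φ
      map_add' := fun x y => hext _ _ fun n => by
        refine Eq.trans ?_ (map_add (ι n).ofConv _ _).symm
        rw [hc, map_add, map_add]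
        exact congrArg₂ _ (hc φ x n).symm (hc φ y n).symm
      map_smul' := fun r x => hext _ _ fun n => by
        refine Eq.trans ?_ (map_smul (ι n).ofConv _ _).symm
        rw [hc, map_smul, map_smul]
        exact congrArg _ (hc φ x n).symm }
  have hC : ∀ φ x n, ι n (C φ x) = φ (ρ n x) := hc
  let b := Module.finBasis ℂ V
  let δ : V →ₗ[ℂ] V ⊗[ℂ] A := ∑ i, TensorProduct.mk ℂ V A (b i) ∘ₗ C (b.coord i)
  have hδ : ∀ n x, evalRight V (ι n) (δ x) = ρ n x := by
    intro n x
    simp only [δ, LinearMap.sum_apply, LinearMap.comp_apply, TensorProduct.mk_apply, map_sum,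
      evalRight_tmul, hC]
    exact b.sum_repr (ρ n x)
  refine ⟨⟨δ, ?_, ?_⟩, fun n => LinearMap.ext (hδ n), ?_⟩
  · ext x
    refine hι.eq_of_evalPair fun m n => ?_
    have h1 := evalPair_assoc_rTensor (ι m) (ι n) δ (δ x)
    have h2 := evalPair_lTensor_comul (ι m) (ι n) (δ x)
    rw [← map_mul] at h2
    rw [hδ, hδ, ← Module.End.mul_apply, ← map_mul, ← hδ] at h1
    exact h1.trans h2.symm
  · ext x
    have h1 := hδ 1 x
    rw [map_one, map_one] at h1
    exact h1
  · rintro ⟨δ', h1, h2⟩ h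
    have : δ' = δ := by
      ext x
      rw [← sub_eq_zero]
      refine hι.eq_zero_of_evalRight _ fun n => ?_
      rw [map_sub, hδ, sub_eq_zero]
      exact LinearMap.congr_fun (h n) x
    subst this
    rfl

/-- A subspace is algebraically stable as soon as it is stable under a Zariski dense set of points,
since points of the dense set separate the elements of `(V ⧸ W) ⊗ A`. -/
lemma ZariskiDense.isSub_iff (hι : ZariskiDense ι) (σ : AlgRep A V) (W : Submodule ℂ V) :
    σ.IsSub W ↔ ∀ n, ∀ x ∈ W, σ.act (ι n) x ∈ W := by
  constructor
  · intro h n x hx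
    obtain ⟨t, ht⟩ := h x hx
    rw [AlgRep.act_apply, ← ht, evalRight_rTensor]
    exact Subtype.prop _
  · intro h x hx
    have hex : Function.Exact (W.subtype.rTensor A) (W.mkQ.rTensor A) :=
      rTensor_exact A (LinearMap.exact_subtype_mkQ W) W.mkQ_surjective
    refine (hex _).1 (hι.eq_zero_of_evalRight _ fun n => ?_)
    rw [evalRight_rTensor, Submodule.mkQ_apply, Submodule.Quotient.mk_eq_zero]
    exact h n x hx

/-- Functions on a reductive group restrict to semisimple coefficients along a Zariski dense
homomorphism: a function lies in the span of its translates, which is finite dimensional and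
underlies an algebraic representation. -/
lemma ZariskiDense.isSemisimpleCoefficient (hι : ZariskiDense ι) (hA : IsReductiveGroup A)
    (a : A) : IsSemisimpleCoefficient fun n => ι n a := by
  let reg := (regularAlgRep A).comp ι
  let W : Submodule ℂ A := Submodule.span ℂ (Set.range fun n => reg n a)
  have hWreg : ∀ n, ∀ x ∈ W, reg n x ∈ W := by
    intro n x hx
    induction hx using Submodule.span_induction with
    | mem x hx =>
      obtain ⟨m, rfl⟩ := hx
      refine Submodule.subset_span ⟨n * m, ?_⟩
      simp only [map_mul, Module.End.mul_apply]
    | zero => simp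
    | add x y _ _ hx hy => simpa using W.add_mem hx hy
    | smul r x _ hx => simpa using W.smul_mem r hx
  have haW : a ∈ W := Submodule.subset_span ⟨1, by simp⟩
  have : FiniteDimensional ℂ W := by
    obtain ⟨W', hW', h⟩ := exists_fg_evalRight_mem ((regularAlgRep A).coact a)
    have hle : W ≤ W' := Submodule.span_le.2 (by
      rintro _ ⟨n, rfl⟩
      exact h (ι n))
    have : FiniteDimensional ℂ W' := Module.Finite.iff_fg.2 hW'
    exact Submodule.finiteDimensional_of_le hle
  let τ : Representation ℂ N W := Subrepresentation.toRepresentation ⟨W, fun n x => hWreg n x⟩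
  let e : W ≃ₗ[ℂ] (Fin (Module.finrank ℂ W) → ℂ) := (Module.finBasis ℂ W).equivFun
  let ρ : Representation ℂ N (Fin (Module.finrank ℂ W) → ℂ) :=
    { toFun := fun n => e.toLinearMap ∘ₗ τ n ∘ₗ e.symm.toLinearMap
      map_one' := by ext; simp
      map_mul' := fun m n => by ext; simp }
  have hρ : ∀ n x, ((e.symm (ρ n x) : W) : A) = reg n (e.symm x) := fun n x => by
    simp [ρ, τ, Subrepresentation.toRepresentation]
  obtain ⟨σ, hσ, -⟩ := hι.existsUnique_algRep ρ fun φ x => by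
    obtain ⟨ψ, hψ⟩ := LinearMap.exists_extend (φ ∘ₗ e.toLinearMap)
    -- The coefficients of the regular representation are functions on the group scheme.
    refine ⟨TensorProduct.lid ℂ A (ψ.rTensor A ((regularAlgRep A).coact (e.symm x))), fun n => ?_⟩
    rw [points_apply_lid_rTensor]
    have h1 : ψ (e.symm (ρ n x) : W) = φ (ρ n x) :=
      (LinearMap.congr_fun hψ (e.symm (ρ n x))).trans (by simp)
    rw [← h1, hρ]
    rfl
  -- Evaluation at the identity turns the translates of `a` into its values.
  refine ⟨_, ρ, Coalgebra.counit ∘ₗ W.subtype ∘ₗ e.symm.toLinearMap, e ⟨a, haW⟩, ?_, fun n => ?_⟩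
  · rw [semisimple_iff]
    intro U hU
    obtain ⟨U', hU', hc⟩ := hA.completelyReducible _ σ U
      ((hι.isSub_iff σ U).2 fun n => by rw [hσ]; exact hU n)
    exact ⟨U', fun n => by rw [← hσ]; exact (hι.isSub_iff σ U').1 hU' n, hc⟩
  · have h1 := hρ n (e ⟨a, haW⟩)
    rw [LinearEquiv.symm_apply_apply] at h1
    exact ((congrArg _ h1).trans (counit_act_regularAlgRep (ι n) a)).symm

end AlgebraicRepresentations

/-! ### Characters of the pro-reductive completion -/

section Characters

variable {H : Type u} [Group H]

lemma laurentPolynomial_algHom_ext {R : Type*} [Semiring R] [Algebra ℂ R]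
    {f g : LaurentPolynomial ℂ →ₐ[ℂ] R}
    (h : f (LaurentPolynomial.T 1) = g (LaurentPolynomial.T 1)) : f = g :=
  AddMonoidAlgebra.algHom_ext' (MonoidHom.ext_mint h) (by ext)

lemma isSemisimpleCoefficient_character (ψ : H →* Circle) :
    IsSemisimpleCoefficient fun h => (ψ h : ℂ) := by
  let ρ : Representation ℂ H ℂ :=
    { toFun := fun h => (ψ h : ℂ) • LinearMap.id
      map_one' := by ext; simp
      map_mul' := fun a b => by ext; simp [mul_comm] }
  have hρ : ρ.IsSemisimpleRepresentation := by
    rw [semisimple_iff]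
    intro W _
    obtain ⟨W', hc⟩ := W.exists_isCompl
    exact ⟨W', fun h w hw => W'.smul_mem _ hw, hc⟩
  convert isSemisimpleCoefficient_of ρ hρ LinearMap.id 1 using 2
  simp [ρ]

/-- Unitary characters of `H` as elements of the coordinate ring of its completion. -/
noncomputable def characterHom : (H →* Circle) →* repAlg H where
  toFun ψ := ⟨fun h => (ψ h : ℂ), Algebra.subset_adjoin (isSemisimpleCoefficient_character ψ)⟩
  map_one' := by
    apply Subtype.ext
    funext h
    simp
  map_mul' ψ ψ' := by
    apply Subtype.ext
    funext h
    simp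

@[simp] lemma characterHom_apply (ψ : H →* Circle) (h : H) :
    (characterHom ψ).1 h = (ψ h : ℂ) := rfl

/-- The algebra homomorphism `ℂ[T, T⁻¹] → repAlg H` sending `T` to a unitary character. -/
noncomputable def characterAlgHom (ψ : H →* Circle) : LaurentPolynomial ℂ →ₐ[ℂ] repAlg H :=
  AddMonoidAlgebra.lift ℂ (repAlg H) ℤ (characterHom.comp (zpowersHom (H →* Circle) ψ))

lemma characterAlgHom_T_one (ψ : H →* Circle) :
    characterAlgHom ψ (LaurentPolynomial.T 1) = characterHom ψ := by
  simp [characterAlgHom, LaurentPolynomial.T, -LaurentPolynomial.single_eq_C_mul_T]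

lemma repAlg_tensor_ext {s t : repAlg H ⊗[ℂ] repAlg H}
    (h : ∀ a b, evalAt₂ a b s = evalAt₂ a b t) : s = t :=
  tensorEval_injective (funext fun p => h p.1 p.2)

lemma comul_repAlg (f : repAlg H) : Coalgebra.comul (R := ℂ) f = repComul f := rfl

lemma counit_repAlg (f : repAlg H) : Coalgebra.counit (R := ℂ) f = f.1 1 := rfl

/-- The character of the completion extending a unitary character of `H`. -/
noncomputable def characterBialgHom (ψ : H →* Circle) : LaurentPolynomial ℂ →ₐc[ℂ] repAlg H :=
  BialgHom.ofAlgHom (characterAlgHom ψ)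
    (laurentPolynomial_algHom_ext (by
      simp [characterAlgHom_T_one, counit_repAlg]))
    (laurentPolynomial_algHom_ext (by
      refine repAlg_tensor_ext fun a b => ?_
      simp [characterAlgHom_T_one, comul_repAlg, evalAt₂_repComul]))

lemma extendsCharacter_iff {χ : LaurentPolynomial ℂ →ₐc[ℂ] repAlg H} {ψ : H →* Circle} :
    ExtendsCharacter χ ψ ↔ χ (LaurentPolynomial.T 1) = characterHom ψ := by
  rw [Subtype.ext_iff, funext_iff]
  rfl

lemma existsUnique_extendsCharacter (ψ : H →* Circle) :
    ∃! χ : LaurentPolynomial ℂ →ₐc[ℂ] repAlg H, ExtendsCharacter χ ψ := by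
  refine ⟨characterBialgHom ψ, extendsCharacter_iff.2 (characterAlgHom_T_one ψ), ?_⟩
  intro χ hχ
  refine BialgHom.coe_toAlgHom_injective (laurentPolynomial_algHom_ext ?_)
  exact (extendsCharacter_iff.1 hχ).trans (characterAlgHom_T_one ψ).symm

/-- The kernel of a character `χ` of finite order, as an ideal: since `ψ = χ(T)` satisfies
`ψ ^ m = 1`, the indicator function of `ker ψ` is the idempotent `m⁻¹ ∑ ψ ^ i`, so a function
vanishing on `ker ψ` is a multiple of `ψ - 1`. -/
lemma mem_kerIdeal_iff {χ : LaurentPolynomial ℂ →ₐc[ℂ] repAlg H} {ψ : H →* Circle}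
    (hψ : IsOfFinOrder ψ) (hχ : ExtendsCharacter χ ψ) (f : repAlg H) :
    f ∈ kerIdeal χ ↔ ∀ h ∈ ψ.ker, f.1 h = 0 := by
  rw [extendsCharacter_iff] at hχ
  constructor
  · intro hf h hh
    have hle : kerIdeal χ ≤ RingHom.ker (evalAt h) := by
      rw [kerIdeal, Ideal.map_le_iff_le_comap]
      intro b hb
      have h1 : (evalAt h).comp (χ : LaurentPolynomial ℂ →ₐ[ℂ] repAlg H) =
          Bialgebra.counitAlgHom ℂ _ := by
        refine laurentPolynomial_algHom_ext ?_
        have h2 : evalAt h (χ (LaurentPolynomial.T 1)) = 1 := by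
          rw [hχ, evalAt_apply, characterHom_apply, MonoidHom.mem_ker.1 hh, Circle.coe_one]
        simpa using h2
      exact (DFunLike.congr_fun h1 b).trans hb
    exact hle hf
  · intro hf
    have hm : 0 < orderOf ψ := hψ.orderOf_pos
    have hT : characterHom ψ - 1 ∈ kerIdeal χ := by
      have : χ (LaurentPolynomial.T 1 - 1) ∈ kerIdeal χ := by
        refine Ideal.mem_map_of_mem (χ : LaurentPolynomial ℂ →ₐ[ℂ] repAlg H) ?_
        simp [RingHom.mem_ker]
      rwa [map_sub, map_one, hχ] at this
    have hdvd : ∀ n : ℕ, characterHom ψ ^ n - 1 ∈ kerIdeal χ := fun n =>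
      Ideal.mem_of_dvd _ (sub_one_dvd_pow_sub_one _ n) hT
    have hsum : f * ∑ i ∈ Finset.range (orderOf ψ), characterHom ψ ^ i = 0 := by
      apply Subtype.ext
      funext h
      have hval : (f * ∑ i ∈ Finset.range (orderOf ψ), characterHom ψ ^ i).1 h =
          f.1 h * ∑ i ∈ Finset.range (orderOf ψ), (ψ h : ℂ) ^ i := by
        rw [← evalAt_apply, map_mul, map_sum]
        simp
      rw [hval]
      by_cases hh : h ∈ ψ.ker
      · simp [hf h hh]
      · have h1 : (ψ h : ℂ) ≠ 1 := fun h1 => hh (Circle.coe_eq_one.1 h1)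
        have h2 : (ψ h : ℂ) ^ orderOf ψ = 1 := by
          rw [← Circle.coe_pow, ← MonoidHom.pow_apply, pow_orderOf_eq_one]
          simp
        rw [geom_sum_eq h1, h2]
        simp
    have hmf : (orderOf ψ : ℂ) • f =
        -(f * ∑ i ∈ Finset.range (orderOf ψ), (characterHom ψ ^ i - 1)) := by
      rw [Finset.sum_sub_distrib, mul_sub, hsum, Finset.sum_const, Finset.card_range,
        Nat.cast_smul_eq_nsmul]
      simp [mul_comm]
    have h3 : (orderOf ψ : ℂ) • f ∈ kerIdeal χ := by
      rw [hmf]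
      exact neg_mem (Ideal.mul_mem_left _ _ (sum_mem fun i _ => hdvd i))
    have h4 := Submodule.smul_of_tower_mem (kerIdeal χ) (orderOf ψ : ℂ)⁻¹ h3
    rwa [smul_smul, inv_mul_cancel₀ (by exact_mod_cast hm.ne'), one_smul] at h4

lemma finiteIndex_ker_of_isOfFinOrder {ψ : H →* Circle} (hψ : IsOfFinOrder ψ) :
    ψ.ker.FiniteIndex := by
  have hm : 0 < orderOf ψ := hψ.orderOf_pos
  have hfin : Finite ψ.range := by
    have : NeZero (orderOf ψ) := ⟨hm.ne'⟩
    let r : ψ.range → rootsOfUnity (orderOf ψ) ℂ := fun z =>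
      ⟨Circle.toUnits z.1, by
        obtain ⟨_, h, rfl⟩ := z
        rw [mem_rootsOfUnity, ← map_pow, ← MonoidHom.pow_apply, pow_orderOf_eq_one]
        simp⟩
    refine Finite.of_injective r fun a b hab => ?_
    have := congrArg (fun z : rootsOfUnity (orderOf ψ) ℂ => ((z : ℂˣ) : ℂ)) hab
    exact Subtype.ext (Circle.ext (by simpa [r] using this))
  have : Finite (H ⧸ ψ.ker) :=
    Finite.of_equiv _ (QuotientGroup.quotientKerEquivRange ψ).symm.toEquiv
  exact Subgroup.finiteIndex_of_finite_quotient

end Characters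

/-! ### Restriction of representation functions to a normal subgroup -/

section Restriction

variable {H : Type u} [Group H] {N : Type v} [Group N] (j : N →* H)

lemma comp_mem_repAlg (hj : j.range.Normal) (f : repAlg H) : f.1 ∘ j ∈ repAlg N := by
  let pull : (H → ℂ) →ₐ[ℂ] (N → ℂ) := AlgHom.pi fun n => Pi.evalAlgHom ℂ (fun _ : H => ℂ) (j n)
  have : repAlg H ≤ (repAlg N).comap pull := by
    refine Algebra.adjoin_le ?_
    rintro f ⟨n, ρ, φ, x, hρ, hf⟩
    refine Algebra.subset_adjoin ⟨n, (ρ.comp j.range.subtype).comp j.rangeRestrict, φ, x,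
      isSemisimpleRepresentation_comp_of_surjective _
        (isSemisimpleRepresentation_restrict j.range ρ hρ) _ j.rangeRestrict_surjective,
      fun h => hf (j h)⟩
  exact this f.2

/-- Restriction of representation functions along a homomorphism with normal image. -/
noncomputable def restrictAlgHom (hj : j.range.Normal) : repAlg H →ₐ[ℂ] repAlg N :=
  ((AlgHom.pi fun n => Pi.evalAlgHom ℂ (fun _ : H => ℂ) (j n)).comp (repAlg H).val).codRestrict
    (repAlg N) (comp_mem_repAlg j hj)

@[simp] lemma restrictAlgHom_apply (hj : j.range.Normal) (f : repAlg H) (n : N) :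
    (restrictAlgHom j hj f).1 n = f.1 (j n) := rfl

/-- Functions extend from `N` to `H` through coinduction of representations. -/
lemma restrictAlgHom_surjective (hj : j.range.Normal) [j.range.FiniteIndex]
    (hinj : Function.Injective j) : Function.Surjective (restrictAlgHom j hj) := by
  have : repAlg N ≤ (restrictAlgHom j hj).range.map (repAlg N).val := by
    refine Algebra.adjoin_le ?_
    rintro f ⟨n, ρ, φ, x, hρ, hf⟩
    let e := MonoidHom.ofInjective hinj
    obtain ⟨F, hF, hFf⟩ := exists_extension_of_isSemisimpleCoefficient j.range (f ∘ e.symm)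
      ⟨n, ρ.comp e.symm.toMonoidHom, φ, x,
        isSemisimpleRepresentation_comp_of_surjective ρ hρ _ e.symm.surjective,
        fun h => hf (e.symm h)⟩
    refine ⟨restrictAlgHom j hj ⟨F, Algebra.subset_adjoin hF⟩, ⟨_, rfl⟩, ?_⟩
    funext n
    refine (hFf (e n)).trans ?_
    simp
  intro f
  obtain ⟨_, ⟨F, rfl⟩, hF⟩ := this f.2
  exact ⟨F, Subtype.ext hF⟩

/-- Restriction of representation functions, as a homomorphism of bialgebras. -/
noncomputable def restrictBialgHom (hj : j.range.Normal) : repAlg H →ₐc[ℂ] repAlg N :=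
  BialgHom.ofAlgHom (restrictAlgHom j hj)
    (AlgHom.ext fun f => congrArg f.1 (map_one j))
    (AlgHom.ext fun f => by
      refine repAlg_tensor_ext fun a b => ?_
      have h1 : (evalAt₂ a b).comp
          (Algebra.TensorProduct.map (restrictAlgHom j hj) (restrictAlgHom j hj)) =
          evalAt₂ (j a) (j b) := by
        ext <;> simp
      refine (DFunLike.congr_fun h1 (repComul f)).trans ?_
      refine Eq.trans ?_ (evalAt₂_repComul a b (restrictAlgHom j hj f)).symm
      rw [evalAt₂_repComul, restrictAlgHom_apply, map_mul])

end Restriction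

/-! ### The kernel of a character of finite order -/

section Kernel

variable {N : Type u} [Group N]

/-- The homomorphism from `N` to the points of `Spec A` that corresponds to `toCompletion N` under an
isomorphism `e : A ≃ repAlg N`. -/
noncomputable def completionPoints {A : Type v} [CommRing A] [HopfAlgebra ℂ A]
    (e : A ≃ₐc[ℂ] repAlg N) : N →* Points A where
  toFun n := WithConv.toConv ((evalAt n).comp ((e : A →ₐc[ℂ] repAlg N) : A →ₐ[ℂ] repAlg N))
  map_one' := by
    refine WithConv.ext (AlgHom.ext fun a => ?_)
    exact CoalgHomClass.counit_comp_apply (e : A →ₐc[ℂ] repAlg N) a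
  map_mul' m n := by
    have h := AlgHom.convMul_comp_bialgHom_distrib (toCompletion N m) (toCompletion N n)
      (e : A →ₐc[ℂ] repAlg N)
    rw [← map_mul] at h
    exact WithConv.ext h

variable {A : Type v} [CommRing A] [HopfAlgebra ℂ A] (e : A ≃ₐc[ℂ] repAlg N)

lemma completionPoints_apply (n : N) (a : A) : completionPoints e n a = (e a).1 n := rfl

lemma isProReductiveCompletion_completionPoints :
    IsProReductiveCompletion (completionPoints e) := by
  refine ⟨e.symm, fun n f => ?_⟩
  rw [completionPoints_apply, BialgEquiv.apply_symm_apply]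
  rfl

lemma zariskiDense_completionPoints : ZariskiDense (completionPoints e) := by
  intro a ha
  have : e a = 0 := eq_zero_of_evalAt _ ha
  rw [← e.symm_apply_apply a, this, map_zero]

lemma exists_completionPoints_eq (f : N → ℂ) (hf : IsSemisimpleCoefficient f) :
    ∃ a : A, ∀ n, completionPoints e n a = f n := by
  refine ⟨e.symm ⟨f, Algebra.subset_adjoin hf⟩, fun n => ?_⟩
  rw [completionPoints_apply, BialgEquiv.apply_symm_apply]

/-- Universal property of the pro-reductive completion for reductive groups. -/
lemma existsUnique_bialgHom {B : Type w} [CommRing B] [HopfAlgebra ℂ B]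
    (hB : IsReductiveGroup B) (ρ : N →* Points B) (hρ : ZariskiDense ρ) :
    ∃! φ : B →ₐc[ℂ] A, ∀ n b, completionPoints e n (φ b) = ρ n b := by
  have hmem : ∀ b, (AlgHom.pi fun n => (ρ n).ofConv) b ∈ repAlg N := fun b =>
    Algebra.subset_adjoin (hρ.isSemisimpleCoefficient hB b)
  -- `b` goes to the function `n ↦ b (ρ n)`.
  let F : B →ₐ[ℂ] repAlg N := (AlgHom.pi fun n => (ρ n).ofConv).codRestrict (repAlg N) hmem
  have hF : ∀ b n, (F b).1 n = ρ n b := fun _ _ => rfl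
  let Φ : B →ₐc[ℂ] repAlg N := BialgHom.ofAlgHom F
    (AlgHom.ext fun b => by
      change ρ 1 b = Coalgebra.counit b
      rw [map_one]
      rfl)
    (AlgHom.ext fun b => repAlg_tensor_ext fun m n => by
      refine Eq.trans ?_ (evalAt₂_repComul m n (F b)).symm
      rw [hF, map_mul, ← evalPair_comul]
      change evalAt₂ m n (Algebra.TensorProduct.map F F (Coalgebra.comul (R := ℂ) b)) = _
      generalize Coalgebra.comul (R := ℂ) b = t
      induction t with
      | zero => simp
      | tmul x y => simp [hF]
      | add x y hx hy => simp only [map_add, hx, hy])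
  refine ⟨(e.symm : repAlg N →ₐc[ℂ] A).comp Φ, fun n b => ?_, fun φ hφ => ?_⟩
  · change (e (e.symm (Φ b))).1 n = _
    rw [BialgEquiv.apply_symm_apply]
    rfl
  · ext b
    apply e.toEquiv.injective
    change e (φ b) = e (e.symm (Φ b))
    rw [BialgEquiv.apply_symm_apply]
    exact Subtype.ext (funext fun n => hφ n b)

/-- The coordinate ring of the kernel of a character of finite order is the algebra of
representation functions of the kernel of its restriction to the abstract group. -/
lemma exists_kerAlg_bialgEquiv {H : Type v} [Group H] (j : N →* H) (hj : Function.Injective j)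
    {χ : LaurentPolynomial ℂ →ₐc[ℂ] repAlg H} {ψ : H →* Circle} (hψ : IsOfFinOrder ψ)
    (hχ : ExtendsCharacter χ ψ) (hker : j.range = ψ.ker) :
    ∃ e : KerAlg χ ≃ₐc[ℂ] repAlg N, ∀ (n : N) (f : repAlg H),
      (e (Ideal.Quotient.mk (kerIdeal χ) f)).1 n = f.1 (j n) := by
  have hnormal : j.range.Normal := hker ▸ inferInstance
  have : j.range.FiniteIndex := hker ▸ finiteIndex_ker_of_isOfFinOrder hψ
  let res := restrictAlgHom j hnormal
  have hres : ∀ f, f ∈ kerIdeal χ ↔ res f = 0 := fun f => by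
    rw [mem_kerIdeal_iff hψ hχ, ← hker, Subtype.ext_iff, funext_iff]
    exact ⟨fun h n => h _ ⟨n, rfl⟩, by rintro h _ ⟨n, rfl⟩; exact h n⟩
  let E : KerAlg χ →ₐ[ℂ] repAlg N := Ideal.Quotient.liftₐ _ res fun f hf => (hres f).1 hf
  let resB := restrictBialgHom j hnormal
  let Eb : KerAlg χ →ₐc[ℂ] repAlg N := BialgHom.ofAlgHom E
    (Ideal.Quotient.algHom_ext ℂ (BialgHom.counitAlgHom_comp resB))
    (Ideal.Quotient.algHom_ext ℂ (by
      refine Eq.trans ?_ (BialgHom.map_comp_comulAlgHom resB)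
      refine AlgHom.ext fun f => ?_
      change Algebra.TensorProduct.map E E (TensorProduct.map _ _ (Coalgebra.comul (R := ℂ) f)) =
        Algebra.TensorProduct.map res res (Coalgebra.comul (R := ℂ) f)
      generalize Coalgebra.comul (R := ℂ) f = t
      induction t with
      | zero => simp
      | tmul x y => rfl
      | add x y hx hy => simp only [map_add, hx, hy]))
  refine ⟨BialgEquiv.ofBijective Eb ⟨?_, ?_⟩, fun n f => rfl⟩
  · rw [injective_iff_map_eq_zero]
    intro a ha
    obtain ⟨f, rfl⟩ := Ideal.Quotient.mk_surjective a
    exact Ideal.Quotient.eq_zero_iff_mem.2 ((hres f).2 ha)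
  · intro f
    obtain ⟨F, hF⟩ := restrictAlgHom_surjective j hnormal hj f
    exact ⟨Ideal.Quotient.mk _ F, hF⟩

end Kernel

end ProReductive

theorem mainTheorem5 {X Y : Type*}
    [TopologicalSpace X] [TopologicalSpace Y]
    (p : C(Y, X)) (hp : IsCoveringMap p) (y : Y)
    (χ' : FundamentalGroup X (p y) →* Circle) (hχ' : IsOfFinOrder χ')
    (hY : (FundamentalGroup.map p y).range = χ'.ker) :
    -- the character extends uniquely to the pro-reductive completion `G` of `π₁(X)`
    (∃! χ : LaurentPolynomial ℂ →ₐc[ℂ] repAlg (FundamentalGroup X (p y)),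
      ExtendsCharacter χ χ') ∧
    ∀ χ : LaurentPolynomial ℂ →ₐc[ℂ] repAlg (FundamentalGroup X (p y)),
      ExtendsCharacter χ χ' →
      -- `π₁(Y) → π₁(X) → G(ℂ)` factors through `K(ℂ)`, where `K = ker χ`
      ∃ ι : FundamentalGroup Y y →* Points (KerAlg χ),
        (∀ (γ : FundamentalGroup Y y) (f : repAlg (FundamentalGroup X (p y))),
          ι γ (Ideal.Quotient.mk (kerIdeal χ) f) =
            toCompletion _ (FundamentalGroup.map p y γ) f) ∧
        -- every semisimple representation of `π₁(Y)` extends uniquely to `K`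
        (∀ (V : Type*) [AddCommGroup V] [Module ℂ V] [FiniteDimensional ℂ V]
          (ρ : Representation ℂ (FundamentalGroup Y y) V), ρ.IsSemisimpleRepresentation →
          ∃! σ : AlgRep (KerAlg χ) V, ∀ γ, σ.act (ι γ) = ρ γ) ∧
        -- `K` is the pro-reductive completion of `π₁(Y)`
        IsProReductiveCompletion ι ∧
        -- `K` has the universal property of the pro-reductive completion of `π₁(Y)`
        (∀ (B : Type*) [CommRing B] [HopfAlgebra ℂ B], IsReductiveGroup B →
          ∀ ρ : FundamentalGroup Y y →* Points B, ZariskiDense ρ →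
          ∃! φ : B →ₐc[ℂ] KerAlg χ, ∀ γ b, ι γ (φ b) = ρ γ b) := by
  refine ⟨existsUnique_extendsCharacter χ', fun χ hχ => ?_⟩
  obtain ⟨e, he⟩ := exists_kerAlg_bialgEquiv (FundamentalGroup.map p y)
    (hp.injective_path_homotopic_map y y) hχ' hχ hY
  refine ⟨completionPoints e, he, fun V _ _ _ ρ hρ => ?_,
    isProReductiveCompletion_completionPoints e,
    fun B _ _ hB ρ hρ => existsUnique_bialgHom e hB ρ hρ⟩
  exact (zariskiDense_completionPoints e).existsUnique_algRep ρ fun φ x =>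
    exists_completionPoints_eq e _ (isSemisimpleCoefficient_of ρ hρ φ x)
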